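/- Let $\langle L_\alpha:\alpha\in On\rangle$ be the constructible hierarchy: $L_0=\emptyset$; $L_{\beta+1}$ is the set of subsets of $L_\beta$ that are first-order definable over $\langle L_\beta,\in\rangle$ with parameters from $L_\beta$; and $L_\lambda=\bigcup_{\beta<\lambda}L_\beta$ for limit $\lambda$. An element $a\in\mathbb{N}^{\mathbb{N}}$ is identified with its graph, a set of ordered pairs of von Neumann natural numbers, and for $n\in\mathbb{N}$ its $n$-th projection $a_n\in\mathbb{N}^{\mathbb{N}}$ is $a_n(m)=a(2^n(2m+1))$. Codes. (i) $f\in\mathbb{N}^{\mathbb{N}}$ codes the real number $r$ if $f(m+2)\in\{0,1\}$ for all $m\ge 0$ and $r=f(0)-f(1)+\sum_{m\ge 0}f(m+2)2^{-(m+1)}$. (ii) $y\in\mathbb{N}^{\mathbb{N}}$ codes the sequence of reals $\{y_n\}_{n\in\mathbb{N}}$ if for every $n\ge 0$ the $n$-th projection of $y$ codes the real $y_n$. (iii) Let $I_0,I_1,\dots$ be the effective enumeration of the bounded open intervals with rational endpoints given by $I_n=\big(\tfrac{a-b}{d+1},\tfrac{a-b+e+1}{d+1}\big)$ for $n=\langle\langle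 a,b\rangle,\langle d,e\rangle\rangle$, where $\langle i,j\rangle=j^2+i$ if $i<j$ and $\langle i,j\rangle=i^2+i+j$ otherwise. Then $a\in\mathbb{N}^{\mathbb{N}}$ codes the open set $G(a)=\bigcup\{I_n: a(n)=1\}\subseteq\mathbb{R}$. For an ordinal $\alpha$, let $\mathcal{G}_\alpha$ be the family of open sets $G\subseteq\mathbb{R}$ with $\mathbb{Q}\subseteq G$ that have a code in $\mathbb{N}^{\mathbb{N}}\cap L_\alpha$. **Theorem 1E.** Let $\alpha$ be an ordinal, let $y\in\mathbb{N}^{\mathbb{N}}\cap L_\alpha$ code a sequence of reals $\{y_n\}_{n\in\mathbb{N}}$ that converges (in the Euclidean topology) to its term $y_0$, and let $x\in\mathbb{N}^{\mathbb{N}}\cap L_\alpha$ be such that $G_n:=G(x_n)\in\mathcal{G}_\alpha$ for every $n\in\mathbb{N}$. Put $T=\bigcap_{n\in\mathbb{N}}G_n$. Then there are a real number $c$ and $M\in\mathbb{N}$ such that $$y_0+c\in T\qquad\text{and}\qquad y_m+c\in T\ \text{ for all } m>M,$$ and $c$ has a code in $\mathbb{N}^{\mathbb{N}}\cap L_{\alpha+\omega}$.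 -/

import Mathlib

universe u

/-! ### The constructible hierarchy -/

/-- The only non-logical symbol of the language of set theory: the binary relation `∈`. -/
inductive MemRel : ℕ → Type
  | mem : MemRel 2

/-- The first-order language of set theory (equality is a logical symbol). -/
def LST : FirstOrder.Language.{0, 0} := ⟨fun _ => Empty, MemRel⟩

/-- A set `A` as a structure `⟨A, ∈⟩` for the language of set theory. -/
instance setStructure (A : ZFSet.{u}) : LST.Structure {z : ZFSet.{u} // z ∈ A} where
  funMap := fun f => Empty.elim f
  RelMap := fun R v => match R, v with
    | MemRel.mem, v => (v 0).1 ∈ (v 1).1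

/-- `defPowerset A` is the set of those subsets of `A` which are definable over `⟨A, ∈⟩` by a
first-order formula with parameters from `A`. -/
noncomputable def defPowerset (A : ZFSet.{u}) : ZFSet.{u} :=
  ZFSet.sep (fun s => (Set.univ : Set {z : ZFSet.{u} // z ∈ A}).Definable₁ LST {z | z.1 ∈ s})
    (ZFSet.powerset A)

/-- The levels `L_α` of the constructible hierarchy. -/
noncomputable def constructibleLevel (α : Ordinal.{u}) : ZFSet.{u} :=
  Ordinal.limitRecOn α ∅ (fun _ A => defPowerset A)
    (fun β _ L => ZFSet.iUnion (fun γ : Set.Iio β => L γ.1 γ.2))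

theorem constructibleLevel_zero : constructibleLevel.{u} 0 = ∅ :=
  Ordinal.limitRecOn_zero _ _ _

theorem constructibleLevel_add_one (β : Ordinal.{u}) :
    constructibleLevel (β + 1) = defPowerset (constructibleLevel β) :=
  Ordinal.limitRecOn_add_one _ _ _ _

theorem constructibleLevel_limit (β : Ordinal.{u}) (h : Order.IsSuccLimit β) :
    constructibleLevel β = ZFSet.iUnion (fun γ : Set.Iio β => constructibleLevel γ.1) :=
  Ordinal.limitRecOn_limit _ _ _ _ h

/-! ### Codes -/

/-- The element of Baire space `f : ℕ → ℕ` as a set: its graph, made of Kuratowski pairs of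
von Neumann natural numbers. -/
noncomputable def baireSet (f : ℕ → ℕ) : ZFSet.{u} :=
  ZFSet.range (fun n : ℕ =>
    ZFSet.pair (Ordinal.toZFSet (n : Ordinal.{u})) (Ordinal.toZFSet ((f n : ℕ) : Ordinal.{u})))

/-- `f ∈ ℕ^ℕ ∩ L_α`. -/
def InLevel (α : Ordinal.{u}) (f : ℕ → ℕ) : Prop := baireSet.{u} f ∈ constructibleLevel α

/-- The `n`-th projection `a_n` of `a`. -/
def proj (a : ℕ → ℕ) (n : ℕ) : ℕ → ℕ := fun m => a (2 ^ n * (2 * m + 1))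

/-- `f` codes the real number `r` with integer part `f 0 - f 1` and binary digits `f 2, f 3, …`.
Every real number has such a code. -/
def CodesReal (f : ℕ → ℕ) (r : ℝ) : Prop :=
  (∀ m, f (m + 2) ≤ 1) ∧
    HasSum (fun m : ℕ => (f (m + 2) : ℝ) / 2 ^ (m + 1)) (r - ((f 0 : ℝ) - (f 1 : ℝ)))

/-- Left endpoint of the interval `I_n`. With `n = ⟨⟨a, b⟩, ⟨d, e⟩⟩` it is `(a - b) / (d + 1)`. -/
noncomputable def leftEnd (n : ℕ) : ℝ :=
  ((n.unpair.1.unpair.1 : ℝ) - (n.unpair.1.unpair.2 : ℝ)) / ((n.unpair.2.unpair.1 : ℝ) + 1)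

/-- Right endpoint of the interval `I_n`. With `n = ⟨⟨a, b⟩, ⟨d, e⟩⟩` it is
`(a - b) / (d + 1) + (e + 1) / (d + 1)`. -/
noncomputable def rightEnd (n : ℕ) : ℝ :=
  leftEnd n + ((n.unpair.2.unpair.2 : ℝ) + 1) / ((n.unpair.2.unpair.1 : ℝ) + 1)

/-- An explicit enumeration `I_n` of the nonempty bounded open intervals with rational ends. -/
def ratInterval (n : ℕ) : Set ℝ := Set.Ioo (leftEnd n) (rightEnd n)

/-- The open set `G(a) = ⋃ {I_n : n ∈ a}` coded by `a`, where `n ∈ a` means `a n = 1`. -/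
def openOfCode (a : ℕ → ℕ) : Set ℝ := ⋃ n ∈ {n : ℕ | a n = 1}, ratInterval n

/-- The `G_δ` set `H(a) = ⋂ₙ G(a_n)` coded by `a`. -/
def gdeltaOfCode (a : ℕ → ℕ) : Set ℝ := ⋂ n : ℕ, openOfCode (proj a n)

/-- The family `𝒢_α` of the open sets of reals that contain `ℚ` and have a code in `L_α`. -/
def codedOpenSupersets (α : Ordinal.{u}) : Set (Set ℝ) :=
  {G | IsOpen G ∧ Set.range ((↑) : ℚ → ℝ) ⊆ G ∧ ∃ a : ℕ → ℕ, InLevel α a ∧ openOfCode a = G}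

/-! Each `G_n` is open and contains `ℚ`, so for every pair `(m, n)` the set of `c` with `Y m + c ∈
G_n` is open and dense. There are countably many pairs, so the Baire category argument gives one `c`
with `Y m + c ∈ T` for every `m`. What must be controlled is where a code of `c` appears.

The category argument is made effective by nested dyadic intervals starting from `[0, 1]`. At step
`k = ⟨m, n⟩` the current interval is replaced by the subinterval of least code whose translate by `Y
m` provably lies in one interval `I_j` of `G_n` (`StepRel`). Such a subinterval exists because a
rational lies strictly inside the translate of the current interval (`exists_stepRel`). Closeness to
`Y m` is tested on finitely many digits of its code, so the test is an inequality between natural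
numbers. The binary digits of the limit `c` are read off the numerators
(`exists_codesReal_digitCode`).

The code of `c` is therefore arithmetical in `x` and `y`. An `L_α` containing a real satisfies `ω ≤
α`, so it contains every finite set of pairs of numbers; quantifying over these makes recursion
first-order over `⟨L_α, ∈⟩` (`NatDefinableFun.prec`, `natCoding_levelNat`). Hence the graph of the
code is definable over `L_α` with parameters `x` and `y`, and belongs to `L_{α+1}`
(`inLevel_add_one_of_arithFun`). -/

/-! ### Relations between natural numbers that are definable in a structure -/

section NatDefinable

variable {L : FirstOrder.Language.{0, 0}} {M : Type*} [L.Structure M]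

/-- A relation between elements of `M` and natural numbers is definable, with parameters, when the
natural number `n` is represented by the element `e n` of `M`. -/
def NatDefinable (L : FirstOrder.Language.{0, 0}) {M : Type*} [L.Structure M] (e : ℕ → M) {ι κ : Type}
    (P : (ι → M) → (κ → ℕ) → Prop) : Prop :=
  ∃ S : Set (ι ⊕ κ → M), (Set.univ : Set M).Definable L S ∧ ∀ u w, P u w ↔ Sum.elim u (e ∘ w) ∈ S

/-- A function on natural numbers has a definable graph. -/
def NatDefinableFun (L : FirstOrder.Language.{0, 0}) {M : Type*} [L.Structure M] (e : ℕ → M) {κ : Type}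
    (f : (κ → ℕ) → ℕ) : Prop :=
  NatDefinable L e (fun (_ : Empty → M) (w : Option κ → ℕ) => f (w ∘ some) = w none)

/-- The natural numbers are represented in `M` in such a way that `M` codes all finite sets of
pairs of natural numbers. The relation `app c i a` says that the pair `(i, a)` belongs to the set
with code `c`. -/
structure NatCoding (L : FirstOrder.Language.{0, 0}) {M : Type*} [L.Structure M] (e : ℕ → M)
    (app : M → M → M → Prop) : Prop where
  injective : Function.Injective e
  range : (Set.univ : Set M).Definable L {v : Unit → M | v () ∈ Set.range e}
  succ : NatDefinable L e (fun (_ : Empty → M) (w : Bool → ℕ) => w true = w false + 1)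
  definable_app : (Set.univ : Set M).Definable L {v : Fin 3 → M | app (v 0) (v 1) (v 2)}
  exists_code : ∀ F : Finset (ℕ × ℕ), ∃ c, ∀ i a, app c (e i) (e a) ↔ (i, a) ∈ F

/-! ### Closure under connectives, quantifiers and substitution. -/

namespace NatDefinable

variable {e : ℕ → M} {app : M → M → M → Prop} {ι ι' κ κ' : Type}
  {P Q : (ι → M) → (κ → ℕ) → Prop}

theorem congr (h : NatDefinable L e P) (hPQ : ∀ u w, P u w ↔ Q u w) : NatDefinable L e Q := by
  obtain ⟨S, hS, h⟩ := h
  exact ⟨S, hS, fun u w => (hPQ u w).symm.trans (h u w)⟩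

theorem not (h : NatDefinable L e P) : NatDefinable L e (fun u w => ¬ P u w) := by
  obtain ⟨S, hS, h⟩ := h
  exact ⟨Sᶜ, hS.compl, fun u w => not_congr (h u w)⟩

theorem and (hP : NatDefinable L e P) (hQ : NatDefinable L e Q) :
    NatDefinable L e (fun u w => P u w ∧ Q u w) := by
  obtain ⟨S, hS, h⟩ := hP
  obtain ⟨T, hT, h'⟩ := hQ
  exact ⟨S ∩ T, hS.inter hT, fun u w => and_congr (h u w) (h' u w)⟩

theorem or (hP : NatDefinable L e P) (hQ : NatDefinable L e Q) :
    NatDefinable L e (fun u w => P u w ∨ Q u w) :=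
  (hP.not.and hQ.not).not.congr fun _ _ => by tauto

theorem imp (hP : NatDefinable L e P) (hQ : NatDefinable L e Q) :
    NatDefinable L e (fun u w => P u w → Q u w) :=
  (hP.and hQ.not).not.congr fun _ _ => by tauto

theorem iff (hP : NatDefinable L e P) (hQ : NatDefinable L e Q) :
    NatDefinable L e (fun u w => P u w ↔ Q u w) :=
  ((hP.imp hQ).and (hQ.imp hP)).congr fun _ _ => by tauto

theorem reindex (h : NatDefinable L e P) (σ : ι → ι') (τ : κ → κ') :
    NatDefinable L e (fun (u : ι' → M) (w : κ' → ℕ) => P (u ∘ σ) (w ∘ τ)) := by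
  obtain ⟨S, hS, h⟩ := h
  refine ⟨_, hS.preimage_comp (Sum.map σ τ), fun u w => ?_⟩
  rw [Set.mem_preimage, Sum.elim_comp_map]
  exact h (u ∘ σ) (w ∘ τ)

theorem forall_finite [Finite ι'] {P : ι' → (ι → M) → (κ → ℕ) → Prop}
    (h : ∀ i, NatDefinable L e (P i)) : NatDefinable L e (fun u w => ∀ i, P i u w) := by
  choose S hS h using h
  refine ⟨⋂ i, S i, Set.definable_iInter_of_finite hS, fun u w => ?_⟩
  simp [h]

theorem exists_elem {P : (ι → M) → M → (κ → ℕ) → Prop}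
    (h : NatDefinable L e (fun (u : Option ι → M) w => P (u ∘ some) (u none) w)) :
    NatDefinable L e (fun u w => ∃ c, P u c w) := by
  obtain ⟨S, hS, h⟩ := h
  let σ : Option ι ⊕ κ → (ι ⊕ κ) ⊕ Unit :=
    Sum.elim (fun o => o.elim (Sum.inr ()) (fun i => Sum.inl (Sum.inl i)))
      (fun k => Sum.inl (Sum.inr k))
  refine ⟨_, (hS.preimage_comp σ).exists_of_finite, fun u w => ?_⟩
  have key : ∀ c : Unit → M, Sum.elim (Sum.elim u (e ∘ w)) c ∘ σ =
      Sum.elim (fun o : Option ι => o.elim (c ()) u) (e ∘ w) := by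
    intro c
    funext x
    rcases x with (_ | i) | k <;> rfl
  simp only [Set.mem_preimage, Set.mem_ofPred_eq, key, ← h]
  exact ⟨fun ⟨c, hc⟩ => ⟨fun _ => c, hc⟩, fun ⟨c, hc⟩ => ⟨c (), hc⟩⟩

theorem forall_elem {P : (ι → M) → M → (κ → ℕ) → Prop}
    (h : NatDefinable L e (fun (u : Option ι → M) w => P (u ∘ some) (u none) w)) :
    NatDefinable L e (fun u w => ∀ c, P u c w) :=
  (exists_elem (P := fun u c w => ¬ P u c w) h.not).not.congr fun _ _ => by simp

theorem exists_nats [Finite κ'] (hc : NatCoding L e app)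
    {P : (ι → M) → (κ → ℕ) → (κ' → ℕ) → Prop}
    (h : NatDefinable L e (fun u (w : κ ⊕ κ' → ℕ) => P u (w ∘ Sum.inl) (w ∘ Sum.inr))) :
    NatDefinable L e (fun u w => ∃ w', P u w w') := by
  obtain ⟨S, hS, h⟩ := h
  let σ : ι ⊕ (κ ⊕ κ') → (ι ⊕ κ) ⊕ κ' := (Equiv.sumAssoc ι κ κ').symm
  -- `S` is unconstrained away from the numerals, so the quantifier has to be relativised to the
  -- range of `e`.
  have hr : (Set.univ : Set M).Definable L
      (⋂ k : κ', {v : (ι ⊕ κ) ⊕ κ' → M | v (Sum.inr k) ∈ Set.range e}) :=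
    Set.definable_iInter_of_finite fun k => hc.range.preimage_comp (fun _ => Sum.inr k)
  refine ⟨_, ((hS.preimage_comp σ).inter hr).exists_of_finite, fun u w => ?_⟩
  have key : ∀ w' : κ' → ℕ, Sum.elim (Sum.elim u (e ∘ w)) (e ∘ w') ∘ σ =
      Sum.elim u (e ∘ Sum.elim w w') := by
    intro c
    funext x
    rcases x with i | k | k <;> rfl
  constructor
  · rintro ⟨w', hw⟩
    refine ⟨e ∘ w', ?_, by simp⟩
    rw [Set.mem_preimage, key, ← h]
    exact hw
  · rintro ⟨c, hc1, hc2⟩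
    have hc2 : ∀ k, ∃ n, e n = c k := by simpa using hc2
    choose w' hw' using hc2
    obtain rfl : e ∘ w' = c := funext hw'
    rw [Set.mem_preimage, key, ← h] at hc1
    exact ⟨w', hc1⟩

theorem exists_nat (hc : NatCoding L e app) {P : (ι → M) → (κ → ℕ) → ℕ → Prop}
    (h : NatDefinable L e (fun u (w : Option κ → ℕ) => P u (w ∘ some) (w none))) :
    NatDefinable L e (fun u w => ∃ n, P u w n) := by
  refine (exists_nats hc (κ' := Unit) (P := fun u w w' => P u w (w' ()))
    (h.reindex id (fun o => o.elim (Sum.inr ()) Sum.inl))).congr fun u w => ?_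
  exact ⟨fun ⟨c, hc⟩ => ⟨c (), hc⟩, fun ⟨c, hc⟩ => ⟨fun _ => c, hc⟩⟩

theorem forall_nat (hc : NatCoding L e app) {P : (ι → M) → (κ → ℕ) → ℕ → Prop}
    (h : NatDefinable L e (fun u (w : Option κ → ℕ) => P u (w ∘ some) (w none))) :
    NatDefinable L e (fun u w => ∀ n, P u w n) :=
  (exists_nat hc (P := fun u w n => ¬ P u w n) h.not).not.congr fun _ _ => by simp

theorem eq_elem (i j : ι) : NatDefinable L e (fun (u : ι → M) (_ : κ → ℕ) => u i = u j) := by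
  refine ⟨_, (Set.Definable.diagonal (L := L) (Set.univ : Set M)).preimage_comp
    ![Sum.inl i, Sum.inl j], fun u w => ?_⟩
  simp

theorem eq_nat (hc : NatCoding L e app) (i j : κ) :
    NatDefinable L e (fun (_ : ι → M) (w : κ → ℕ) => w i = w j) := by
  refine ⟨_, (Set.Definable.diagonal (L := L) (Set.univ : Set M)).preimage_comp
    ![Sum.inr i, Sum.inr j], fun u w => ?_⟩
  simp [hc.injective.eq_iff]

theorem eq_const (hc : NatCoding L e app) (i : κ) (n : ℕ) :
    NatDefinable L e (fun (_ : ι → M) (w : κ → ℕ) => n = w i) := by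
  refine ⟨_, ((Set.Definable.singleton_of_mem L (Set.mem_univ (e n))).preimage_comp
    (fun _ => Sum.inr i)), fun u w => ?_⟩
  simp [hc.injective.eq_iff, eq_comm]

theorem subst [Finite κ'] (hc : NatCoding L e app) {P : (ι → M) → (κ' → ℕ) → Prop}
    (hP : NatDefinable L e P) {f : κ' → (κ → ℕ) → ℕ} (hf : ∀ i, NatDefinableFun L e (f i)) :
    NatDefinable L e (fun (u : ι → M) (w : κ → ℕ) => P u (fun i => f i w)) := by
  have h1 : NatDefinable L e (fun (_ : ι → M) (w : κ ⊕ κ' → ℕ) =>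
      ∀ i, f i (w ∘ Sum.inl) = (w ∘ Sum.inr) i) :=
    forall_finite fun i => (hf i).reindex Empty.elim (fun o => o.elim (Sum.inr i) Sum.inl)
  have h2 := hP.reindex (id : ι → ι) (Sum.inr : κ' → κ ⊕ κ')
  refine (exists_nats hc (P := fun u w w' => (∀ i, f i w = w' i) ∧ P u w') (h1.and h2)).congr
    fun u w => ?_
  constructor
  · rintro ⟨w', h, h'⟩
    rwa [show (fun i => f i w) = w' from funext h]
  · exact fun h => ⟨_, fun _ => rfl, h⟩

end NatDefinable

/-! ### Primitive recursive functions are definable. -/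

namespace NatDefinableFun

variable {e : ℕ → M} {app : M → M → M → Prop} {ι κ κ' : Type}

theorem proj (hc : NatCoding L e app) (i : κ) : NatDefinableFun L e (fun w : κ → ℕ => w i) :=
  NatDefinable.eq_nat hc (some i) none

theorem const (hc : NatCoding L e app) (n : ℕ) : NatDefinableFun L e (fun _ : κ → ℕ => n) :=
  NatDefinable.eq_const hc none n

theorem reindex {f : (κ → ℕ) → ℕ} (hf : NatDefinableFun L e f) (τ : κ → κ') :
    NatDefinableFun L e (fun w : κ' → ℕ => f (w ∘ τ)) :=
  NatDefinable.reindex hf id (Option.map τ)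

theorem succ (hc : NatCoding L e app) : NatDefinableFun L e (fun w : Unit → ℕ => w () + 1) :=
  (hc.succ.reindex id (fun b => cond b none (some ()))).congr fun _ _ => eq_comm

theorem comp [Finite κ'] (hc : NatCoding L e app) {f : (κ' → ℕ) → ℕ} (hf : NatDefinableFun L e f)
    {g : κ' → (κ → ℕ) → ℕ} (hg : ∀ i, NatDefinableFun L e (g i)) :
    NatDefinableFun L e (fun w => f (fun i => g i w)) := by
  refine NatDefinable.subst hc hf (κ := Option κ)
    (f := fun o w => o.elim (w none) (fun i => g i (w ∘ some))) ?_
  rintro (_ | i)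
  · exact proj hc none
  · exact (hg i).reindex some

theorem app_comp (hc : NatCoding L e app) (x : ι) {s t : (κ → ℕ) → ℕ} (hs : NatDefinableFun L e s)
    (ht : NatDefinableFun L e t) :
    NatDefinable L e (fun (u : ι → M) (w : κ → ℕ) => app (u x) (e (s w)) (e (t w))) := by
  have h : NatDefinable L e
      (fun (u : ι → M) (w : Bool → ℕ) => app (u x) (e (w false)) (e (w true))) := by
    refine ⟨_, hc.definable_app.preimage_comp ![Sum.inl x, Sum.inr false, Sum.inr true], fun u w => ?_⟩
    simp
  refine NatDefinable.subst hc h (f := fun b => cond b t s) ?_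
  rintro (_ | _)
  exacts [hs, ht]

/-- The value at `n` is `z` iff `(n, z)` lies in every coded set that contains the initial pair and
is closed under the recursion step at all indices other than `n`. Exempting `n` lets a finite set
satisfy the closure condition, so codes of finite sets suffice. -/
theorem prec (hc : NatCoding L e app) {f : (κ → ℕ) → ℕ} {g : (Option (Option κ) → ℕ) → ℕ}
    [Finite κ] (hf : NatDefinableFun L e f) (hg : NatDefinableFun L e g) :
    NatDefinableFun L e (fun w : Option κ → ℕ => Nat.rec (f (w ∘ some))
      (fun i z => g (fun o => o.elim i (fun o => o.elim z (w ∘ some)))) (w none)) := by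
  have h1 : NatDefinable L e (fun (u : Option Empty → M) (w : Option (Option κ) → ℕ) =>
      app (u none) (e 0) (e (f (w ∘ some ∘ some)))) :=
    app_comp hc none (const hc 0) (hf.reindex (some ∘ some))
  have h2 : NatDefinable L e (fun (u : Option Empty → M) (w : Option (Option κ) → ℕ) =>
      app (u none) (e (w (some none))) (e (w none))) :=
    app_comp hc none (proj hc _) (proj hc _)
  -- Variables by depth, innermost first: `z`, `i`, the value of the function, the recursion
  -- argument, then the parameters.
  have h3 : NatDefinable L e
      (fun (u : Option Empty → M) (w : Option (Option (Option (Option κ))) → ℕ) =>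
      app (u none) (e (w (some none))) (e (w none))) :=
    app_comp hc none (proj hc _) (proj hc _)
  have h4 : NatDefinable L e
      (fun (u : Option Empty → M) (w : Option (Option (Option (Option κ))) → ℕ) =>
      app (u none) (e (w (some none) + 1)) (e (g (fun o => o.elim (w (some none))
        (fun o => o.elim (w none) (fun k => w (some (some (some (some k)))))))))) := by
    refine app_comp hc none ((succ hc).reindex (fun _ => some none)) ?_
    refine (hg.reindex (fun o => o.elim (some none)
        (fun o => o.elim none (fun k => (some (some (some (some k)))))))).congr fun _ w => ?_
    have : ((w ∘ some) ∘ fun o : Option (Option κ) => o.elim (some none)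
        (fun o => o.elim none (fun k => (some (some (some (some k))))))) =
        fun o => o.elim ((w ∘ some) (some none)) (fun o => o.elim ((w ∘ some) none)
          (fun k => (w ∘ some) (some (some (some (some k)))))) := by
      funext o
      rcases o with _ | _ | k <;> rfl
    exact iff_of_eq (by simp only [this])
  have h5 : NatDefinable L e
      (fun (_ : Option Empty → M) (w : Option (Option (Option (Option κ))) → ℕ) =>
        w (some none) = w (some (some (some none)))) := NatDefinable.eq_nat hc _ _
  have h6 := NatDefinable.forall_nat hc (P := fun u w i => ∀ z, app (u none) (e i) (e z) →
      i = w (some none) ∨ app (u none) (e (i + 1)) (e (g (fun o => o.elim i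
        (fun o => o.elim z (fun k => w (some (some k)))))))) <|
    NatDefinable.forall_nat hc (P := fun u w z => app (u none) (e (w none)) (e z) →
      w none = w (some (some none)) ∨ app (u none) (e (w none + 1)) (e (g (fun o => o.elim (w none)
        (fun o => o.elim z (fun k => w (some (some (some k))))))))) <|
    h3.imp (h5.or h4)
  refine (NatDefinable.forall_elem (P := fun (_ : Empty → M) c (w : Option (Option κ) → ℕ) =>
      (app c (e 0) (e (f (w ∘ some ∘ some))) ∧ ∀ i z, app c (e i) (e z) →
      i = w (some none) ∨ app c (e (i + 1)) (e (g (fun o => o.elim i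
        (fun o => o.elim z (fun k => w (some (some k)))))))) →
      app c (e (w (some none))) (e (w none))) ((h1.and h6).imp h2)).congr fun _ w => ?_
  set r : ℕ → ℕ := fun n => Nat.rec (f (w ∘ some ∘ some))
      (fun i z => g (fun o => o.elim i (fun o => o.elim z (w ∘ some ∘ some)))) n with hr
  change _ ↔ r (w (some none)) = w none
  constructor
  · intro h
    -- The test set is the graph of the recursion up to its argument.
    obtain ⟨c, hcode⟩ := hc.exists_code
      ((Finset.range (w (some none) + 1)).image fun i => (i, r i))
    have := h c ?_
    · rw [hcode] at this
      simp only [Finset.mem_image, Prod.mk.injEq] at this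
      obtain ⟨i, -, rfl, h⟩ := this
      exact h
    · simp only [hcode, Finset.mem_image, Finset.mem_range, Prod.mk.injEq]
      refine ⟨⟨0, by omega, rfl, rfl⟩, ?_⟩
      rintro _ _ ⟨i, hi, rfl, rfl⟩
      by_cases h : i = w (some none)
      · exact Or.inl h
      · exact Or.inr ⟨i + 1, by omega, rfl, rfl⟩
  · rintro h c ⟨h0, hs⟩
    have : ∀ i ≤ w (some none), app c (e i) (e (r i)) := by
      intro i
      induction i with
      | zero => exact fun _ => h0
      | succ i ih =>
        intro hi
        rcases hs i _ (ih (by omega)) with h | h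
        · omega
        · exact h
    rw [← h]
    exact this _ le_rfl

theorem of_primrec' (hc : NatCoding L e app) {n : ℕ} {f : List.Vector ℕ n → ℕ}
    (hf : Nat.Primrec' f) : NatDefinableFun L e (fun w => f (List.Vector.ofFn w)) := by
  induction hf with
  | zero => exact const hc 0
  | succ => 
    refine ((succ hc).reindex (fun _ => 0)).congr fun _ w => ?_
    simp
  | get i => simpa using proj hc i
  | comp g _ _ ihf ihg => exact comp hc ihf ihg
  | @prec n f g _ _ ihf ihg =>
    have hg' : NatDefinableFun L e (fun w : Option (Option (Fin n)) → ℕ =>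
        g (w none ::ᵥ w (some none) ::ᵥ List.Vector.ofFn fun i => w (some (some i)))) := by
      refine (ihg.reindex (Fin.cons none (Fin.cons (some none) fun i => some (some i)))).congr
        fun _ w => ?_
      simp [List.Vector.ofFn]
    refine ((prec hc ihf hg').reindex (fun o => o.elim 0 Fin.succ)).congr fun _ w => ?_
    simp [List.Vector.ofFn, Function.comp_def]

end NatDefinableFun

end NatDefinable

/-! ### Definable predicates and functions on primitively codable types -/

section ArithDefinable

/-- A predicate on a primitively codable type is definable, through the codes of its members. -/
def ArithPred (L : FirstOrder.Language.{0, 0}) {M : Type*} [L.Structure M] (e : ℕ → M)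
    {α : Type*} [Primcodable α] (P : α → Prop) : Prop :=
  NatDefinable L e (fun (_ : Empty → M) (w : Unit → ℕ) =>
    ∃ a, Encodable.decode (w ()) = some a ∧ P a)

/-- A function between primitively codable types has a definable graph. -/
def ArithFun (L : FirstOrder.Language.{0, 0}) {M : Type*} [L.Structure M] (e : ℕ → M)
    {α β : Type*} [Primcodable α] [Primcodable β] (f : α → β) : Prop :=
  ArithPred L e (fun p : α × β => f p.1 = p.2)

variable {L : FirstOrder.Language.{0, 0}} {M : Type*} [L.Structure M] {e : ℕ → M}
  {app : M → M → M → Prop} {α β γ δ : Type*} [Primcodable α] [Primcodable β] [Primcodable γ]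
  [Primcodable δ]

theorem NatDefinableFun.of_primrec (hc : NatCoding L e app) {f : ℕ → ℕ} (hf : Primrec f) :
    NatDefinableFun L e (fun w : Unit → ℕ => f (w ())) := by
  refine ((of_primrec' hc (Nat.Primrec'.prim_iff₁.2 hf)).reindex (fun _ => ())).congr
    fun _ w => ?_
  simp

theorem NatDefinableFun.natPair (hc : NatCoding L e app) :
    NatDefinableFun L e (fun w : Option Unit → ℕ => Nat.pair (w (some ())) (w none)) := by
  refine ((of_primrec' hc Nat.Primrec'.natPair).reindex ![some (), none]).congr fun _ w => ?_
  simp [List.Vector.ofFn]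

/-! ### Closure properties of definable predicates. -/

namespace ArithPred

variable {P Q : α → Prop}

theorem congr (hP : ArithPred L e P) (h : ∀ a, P a ↔ Q a) : ArithPred L e Q :=
  NatDefinable.congr hP fun _ _ => by simp only [h]

theorem comp_primrec (hc : NatCoding L e app) {P : β → Prop} (hP : ArithPred L e P) {f : α → β}
    (hf : Primrec f) : ArithPred L e (fun a => P (f a)) := by
  -- This function is `0` on invalid codes and one more than the code of `f a` otherwise; hence the
  -- predecessor in `h1` and the exclusion of `0` in `h2`.
  have hF : Primrec (fun n : ℕ => Encodable.encode ((Encodable.decode (α := α) n).map f)) :=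
    Primrec.encode.comp (Primrec.option_map Primrec.decode (hf.comp Primrec.snd))
  have h1 := NatDefinable.subst hc hP (fun _ => .of_primrec hc (Primrec.pred.comp hF))
  have h2 := (NatDefinable.subst hc (NatDefinable.eq_const (ι := Empty) hc () 0)
    (fun _ => .of_primrec hc hF)).not
  refine (h2.and h1).congr fun _ w => ?_
  cases h : Encodable.decode (α := α) (w ()) <;> simp

theorem of_primrecPred (hc : NatCoding L e app) (hP : PrimrecPred P) : ArithPred L e P := by
  classical
  have h : ArithPred L e (fun n : ℕ => 1 = n) :=
    (NatDefinable.eq_const hc () 1).congr fun _ w => by simp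
  refine (comp_primrec hc h (Primrec.ite hP (Primrec.const 1) (Primrec.const 0))).congr
    fun a => ?_
  by_cases h : P a <;> simp [h]

theorem and (hP : ArithPred L e P) (hQ : ArithPred L e Q) : ArithPred L e (fun a => P a ∧ Q a) :=
  (NatDefinable.and hP hQ).congr fun _ w => by
    cases h : Encodable.decode (α := α) (w ()) <;> simp

theorem not (hc : NatCoding L e app) (hP : ArithPred L e P) : ArithPred L e (fun a => ¬ P a) :=
  -- Invalid codes satisfy no predicate, so the complement is cut down to the valid ones.
  ((NatDefinable.not hP).and (of_primrecPred (α := α) (P := fun _ => True) hc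
    ⟨inferInstance, Primrec.const _⟩)).congr fun _ w => by
    cases h : Encodable.decode (α := α) (w ()) <;> simp

theorem imp (hc : NatCoding L e app) (hP : ArithPred L e P) (hQ : ArithPred L e Q) :
    ArithPred L e (fun a => P a → Q a) :=
  ((hP.and (hQ.not hc)).not hc).congr fun _ => by tauto

theorem exists_ (hc : NatCoding L e app) {P : α → β → Prop}
    (hP : ArithPred L e (fun p : α × β => P p.1 p.2)) : ArithPred L e (fun a => ∃ b, P a b) := by
  have h := NatDefinable.subst hc hP (fun _ => NatDefinableFun.natPair hc)
  refine (NatDefinable.exists_nat hc (P := fun _ w n =>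
    ∃ p : α × β, Encodable.decode (Nat.pair (w ()) n) = some p ∧ P p.1 p.2) h).congr
      fun _ w => ?_
  cases h : Encodable.decode (α := α) (w ()) with
  | none => simp [h]
  | some a =>
    simp only [Encodable.decode_prod_val, Nat.unpair_pair, h, Option.bind_some]
    constructor
    · rintro ⟨n, p, hn, hp⟩
      cases hb : Encodable.decode (α := β) n with
      | none => simp [hb] at hn
      | some b =>
        simp only [hb, Option.map_some, Option.some.injEq] at hn
        subst hn
        exact ⟨a, rfl, b, hp⟩
    · rintro ⟨_, ⟨⟩, b, hb⟩
      exact ⟨Encodable.encode b, (a, b), by simp, hb⟩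

theorem forall_ (hc : NatCoding L e app) {P : α → β → Prop}
    (hP : ArithPred L e (fun p : α × β => P p.1 p.2)) : ArithPred L e (fun a => ∀ b, P a b) :=
  ((exists_ hc (P := fun a b => ¬ P a b) (hP.not hc)).not hc).congr fun _ => by simp

theorem comp (hc : NatCoding L e app) {P : β → Prop} (hP : ArithPred L e P) {f : α → β}
    (hf : ArithFun L e f) : ArithPred L e (fun a => P (f a)) :=
  (exists_ hc (P := fun a b => f a = b ∧ P b)
    (hf.and (hP.comp_primrec hc Primrec.snd))).congr fun _ => by simp

end ArithPred

/-! ### Closure properties of definable functions. -/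

namespace ArithFun

theorem of_primrec (hc : NatCoding L e app) {f : α → β} (hf : Primrec f) : ArithFun L e f :=
  .of_primrecPred hc (Primrec.eq.comp (hf.comp Primrec.fst) Primrec.snd)

theorem pair (hc : NatCoding L e app) {f : α → β} {g : α → γ} (hf : ArithFun L e f)
    (hg : ArithFun L e g) : ArithFun L e (fun a => (f a, g a)) :=
  ((hf.comp_primrec hc (Primrec.fst.pair (Primrec.fst.comp Primrec.snd))).and
    (hg.comp_primrec hc (Primrec.fst.pair (Primrec.snd.comp Primrec.snd)))).congr
      fun _ => by simp [Prod.ext_iff]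

theorem comp_primrec (hc : NatCoding L e app) {f : β → γ} {g : α → β} (hf : ArithFun L e f)
    (hg : Primrec g) : ArithFun L e (fun a => f (g a)) :=
  ArithPred.comp_primrec hc hf ((hg.comp Primrec.fst).pair Primrec.snd)

theorem comp (hc : NatCoding L e app) {f : β → γ} {g : α → β} (hf : ArithFun L e f)
    (hg : ArithFun L e g) : ArithFun L e (fun a => f (g a)) :=
  ArithPred.comp hc hf (pair hc (hg.comp_primrec hc Primrec.fst) (of_primrec hc Primrec.snd))

theorem eq (hc : NatCoding L e app) {f g : α → β} (hf : ArithFun L e f) (hg : ArithFun L e g) :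
    ArithPred L e (fun a => f a = g a) :=
  ArithPred.comp hc (ArithPred.of_primrecPred hc Primrec.eq) (pair hc hf hg)

/-- Here `g` is only definable, so the computation is witnessed by a list of its successive values.
The default `0` of `getD` is harmless: the conditions determine every entry up to the argument. -/
theorem natRec (hc : NatCoding L e app) {f : α → ℕ} {g : α × ℕ × ℕ → ℕ} (hf : ArithFun L e f)
    (hg : ArithFun L e g) :
    ArithFun L e (fun p : α × ℕ => (Nat.rec (f p.1) (fun i z => g (p.1, i, z)) p.2 : ℕ)) := by
  have hget := Primrec.list_getD (0 : ℕ)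
  have h1 : ArithPred L e (fun q : ((α × ℕ) × ℕ) × List ℕ => q.2.getD 0 0 = f q.1.1.1) :=
    eq hc (of_primrec hc (hget.comp Primrec.snd (Primrec.const 0)))
      (hf.comp_primrec hc (Primrec.fst.comp (Primrec.fst.comp Primrec.fst)))
  have h2 : ArithPred L e (fun q : ((α × ℕ) × ℕ) × List ℕ =>
      ∀ i, i < q.1.1.2 → q.2.getD (i + 1) 0 = g (q.1.1.1, i, q.2.getD i 0)) := by
    refine .forall_ hc (.imp hc (.of_primrecPred hc (Primrec.nat_lt.comp Primrec.snd
      (Primrec.snd.comp (Primrec.fst.comp (Primrec.fst.comp Primrec.fst))))) (eq hc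
        (of_primrec hc (hget.comp (Primrec.snd.comp Primrec.fst) (Primrec.succ.comp Primrec.snd)))
        (hg.comp_primrec hc (Primrec.pair
          (Primrec.fst.comp (Primrec.fst.comp (Primrec.fst.comp Primrec.fst)))
          (Primrec.pair Primrec.snd (hget.comp (Primrec.snd.comp Primrec.fst) Primrec.snd))))))
  have h3 : ArithPred L e (fun q : ((α × ℕ) × ℕ) × List ℕ => q.2.getD q.1.1.2 0 = q.1.2) :=
    .of_primrecPred hc (Primrec.eq.comp (hget.comp Primrec.snd
      (Primrec.snd.comp (Primrec.fst.comp Primrec.fst))) (Primrec.snd.comp Primrec.fst))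
  refine (ArithPred.exists_ hc (P := fun (q : (α × ℕ) × ℕ) (l : List ℕ) => l.getD 0 0 = f q.1.1 ∧
    (∀ i, i < q.1.2 → l.getD (i + 1) 0 = g (q.1.1, i, l.getD i 0)) ∧ l.getD q.1.2 0 = q.2)
      (h1.and (h2.and h3))).congr ?_
  rintro ⟨⟨a, n⟩, m⟩
  dsimp only
  set r : ℕ → ℕ := fun n => Nat.rec (f a) (fun i z => g (a, i, z)) n with hr
  constructor
  · rintro ⟨l, h0, hs, rfl⟩
    have : ∀ i ≤ n, l.getD i 0 = r i := by
      intro i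
      induction i with
      | zero => exact fun _ => h0
      | succ i ih =>
        intro hi
        rw [hs i hi, ih (by omega)]
    exact (this n le_rfl).symm
  · rintro rfl
    have : ∀ i ≤ n, ((List.range (n + 1)).map r).getD i 0 = r i := by
      intro i hi
      simp [List.getD, List.getElem?_range (show i < n + 1 by omega)]
    refine ⟨(List.range (n + 1)).map r, this 0 (by omega), fun i hi => ?_, this n le_rfl⟩
    rw [this _ hi, this _ hi.le]

/-- Being the least witness is definable; `h` rules out the junk value of `sInf ∅`. -/
theorem nat_sInf (hc : NatCoding L e app) {Q : α → ℕ → Prop}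
    (hQ : ArithPred L e (fun p : α × ℕ => Q p.1 p.2)) (h : ∀ a, ∃ n, Q a n) :
    ArithFun L e (fun a => sInf {n | Q a n}) := by
  have h1 : ArithPred L e (fun p : α × ℕ => ∀ k, Q p.1 k → p.2 ≤ k) :=
    .forall_ hc (.imp hc (hQ.comp_primrec hc ((Primrec.fst.comp Primrec.fst).pair Primrec.snd))
      (.of_primrecPred hc (Primrec.nat_le.comp (Primrec.snd.comp Primrec.fst) Primrec.snd)))
  refine (hQ.and h1).congr fun ⟨a, n⟩ => ?_
  constructor
  · rintro ⟨h1, h2⟩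
    exact le_antisymm (Nat.sInf_le h1) (h2 _ (Nat.sInf_mem (h a)))
  · intro hn
    obtain rfl : sInf {n | Q a n} = n := hn
    exact ⟨Nat.sInf_mem (h a), fun k hk => Nat.sInf_le hk⟩

end ArithFun

end ArithDefinable

/-! ### Definability over transitive sets -/

section TransitiveSet

variable {A : ZFSet.{u}} {e : ℕ → {z : ZFSet.{u} // z ∈ A}} {ι κ : Type}

theorem NatDefinable.of_definable {L : FirstOrder.Language.{0, 0}} {M : Type*} [L.Structure M]
    {e : ℕ → M} {P : (ι → M) → Prop} (h : (Set.univ : Set M).Definable L {v | P v}) :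
    NatDefinable L e (fun u (_ : κ → ℕ) => P u) :=
  ⟨_, h.preimage_comp Sum.inl, fun _ _ => Iff.rfl⟩

theorem NatDefinable.definable {L : FirstOrder.Language.{0, 0}} {M : Type*} [L.Structure M]
    {e : ℕ → M} {P : (ι → M) → Prop} (h : NatDefinable L e (fun u (_ : Empty → ℕ) => P u)) :
    (Set.univ : Set M).Definable L {v | P v} := by
  obtain ⟨S, hS, h⟩ := h
  convert hS.preimage_comp (Sum.elim id Empty.elim) using 1
  ext v
  have : v ∘ Sum.elim id Empty.elim = Sum.elim v (e ∘ Empty.elim) := by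
    funext x
    rcases x with x | x
    exacts [rfl, x.elim]
  exact (h v Empty.elim).trans (by rw [Set.mem_preimage, this])

theorem NatDefinable.elim {L : FirstOrder.Language.{0, 0}} {M : Type*} [L.Structure M]
    {e : ℕ → M} {P : (ι ⊕ κ → M) → Prop} (h : NatDefinable L e (fun u (_ : Empty → ℕ) => P u)) :
    NatDefinable L e (fun u w => P (Sum.elim u (e ∘ w))) :=
  ⟨_, h.definable, fun _ _ => Iff.rfl⟩

theorem NatDefinable.eq_param {L : FirstOrder.Language.{0, 0}} {M : Type*} [L.Structure M]
    {e : ℕ → M} (i : ι) (c : M) : NatDefinable L e (fun (u : ι → M) (_ : κ → ℕ) => u i = c) := by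
  refine ⟨_, (Set.Definable.singleton_of_mem L (Set.mem_univ c)).preimage_comp
    (fun _ => Sum.inl i), fun u w => ?_⟩
  simp

theorem natDefinable_mem (i j : ι) :
    NatDefinable LST e (fun u (_ : κ → ℕ) => (u i).1 ∈ (u j).1) := by
  refine .of_definable ?_
  refine Set.Definable.mono (Set.empty_definable_iff.2
    ⟨FirstOrder.Language.Relations.formula₂ (L := LST) MemRel.mem (FirstOrder.Language.var i)
      (FirstOrder.Language.var j), ?_⟩) (Set.empty_subset _)
  ext v
  simp only [Set.mem_ofPred_eq]
  rfl

theorem natDefinable_eq_insert_singleton (hA : A.IsTransitive) (i j k : ι) :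
    NatDefinable LST e (fun u (_ : κ → ℕ) => (u k).1 = {(u i).1, (u j).1}) := by
  refine (NatDefinable.forall_elem (P := fun u c _ => c.1 ∈ (u k).1 ↔ c = u i ∨ c = u j)
    ((natDefinable_mem none (some k)).iff
      ((NatDefinable.eq_elem none (some i)).or (.eq_elem none (some j))))).congr fun u w => ?_
  constructor
  · intro h
    ext z
    rw [ZFSet.mem_pair]
    constructor
    · intro hz
      have := (h ⟨z, hA.subset_of_mem (u k).2 hz⟩).1 hz
      simpa [Subtype.ext_iff] using this
    · rintro (rfl | rfl)
      exacts [(h (u i)).2 (Or.inl rfl), (h (u j)).2 (Or.inr rfl)]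
  · intro h c
    rw [h, ZFSet.mem_pair, Subtype.ext_iff, Subtype.ext_iff]

/-- `A` need not be closed under pairing: the two components `{a}` and `{a, b}` are found in `A` by
transitivity, once the pair itself is there. -/
theorem natDefinable_eq_pair (hA : A.IsTransitive) (i j k : ι) :
    NatDefinable LST e (fun u (_ : κ → ℕ) => (u k).1 = ZFSet.pair (u i).1 (u j).1) := by
  refine (NatDefinable.exists_elem (P := fun u c _ => c.1 = {(u i).1, (u i).1} ∧
      ∃ d : {z // z ∈ A}, d.1 = {(u i).1, (u j).1} ∧ (u k).1 = {c.1, d.1})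
    ((natDefinable_eq_insert_singleton hA (some i) (some i) none).and
      (NatDefinable.exists_elem (P := fun u d _ => d.1 = {(u (some i)).1, (u (some j)).1} ∧
          (u (some k)).1 = {(u none).1, d.1})
        ((natDefinable_eq_insert_singleton hA (some (some i)) (some (some j)) none).and
        (natDefinable_eq_insert_singleton hA (some none) none (some (some k))))))).congr
      fun u w => ?_
  rw [ZFSet.pair]
  constructor
  · rintro ⟨c, hc, d, hd, h⟩
    rw [h, hc, hd, ZFSet.pair_eq_singleton]
  · intro h
    refine ⟨⟨{(u i).1}, hA.subset_of_mem (u k).2 (by simp [h])⟩, by simp,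
      ⟨{(u i).1, (u j).1}, hA.subset_of_mem (u k).2 (by simp [h])⟩, rfl, h⟩

theorem natDefinable_pair_mem (hA : A.IsTransitive) (i j k : ι) :
    NatDefinable LST e (fun u (_ : κ → ℕ) => ZFSet.pair (u i).1 (u j).1 ∈ (u k).1) := by
  refine (NatDefinable.exists_elem (P := fun u c _ => c.1 = ZFSet.pair (u i).1 (u j).1 ∧
      c.1 ∈ (u k).1) ((natDefinable_eq_pair hA (some i) (some j) none).and
        (natDefinable_mem none (some k)))).congr fun u w => ?_
  constructor
  · rintro ⟨c, hc, h⟩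
    rwa [← hc]
  · exact fun h => ⟨⟨_, hA.subset_of_mem (u k).2 h⟩, rfl, h⟩

theorem natDefinable_pair_mem_param (hA : A.IsTransitive) (i j : ι) {s : ZFSet.{u}} (hs : s ∈ A) :
    NatDefinable LST e (fun u (_ : κ → ℕ) => ZFSet.pair (u i).1 (u j).1 ∈ s) :=
  (NatDefinable.exists_elem (P := fun u c _ => c = ⟨s, hs⟩ ∧ ZFSet.pair (u i).1 (u j).1 ∈ c.1)
    ((NatDefinable.eq_param none _).and
      (natDefinable_pair_mem hA (some i) (some j) none))).congr fun u w => by simp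

theorem mem_defPowerset_of_natDefinable {s : ZFSet.{u}} (hs : s ⊆ A)
    (h : NatDefinable LST e (fun (u : Unit → _) (_ : Empty → ℕ) => (u ()).1 ∈ s)) :
    s ∈ defPowerset A :=
  ZFSet.mem_sep.2 ⟨ZFSet.mem_powerset.2 hs, h.definable.preimage_comp (fun _ => 0)⟩

theorem insert_mem_defPowerset (hA : A.IsTransitive) {a s : ZFSet.{u}} (ha : a ∈ A) (hs : s ∈ A) :
    insert a s ∈ defPowerset A := by
  -- No number variable occurs, so any map `ℕ → A` can serve as `e`.
  refine mem_defPowerset_of_natDefinable (e := fun _ => ⟨a, ha⟩) ?_ ?_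
  · intro z hz
    rcases ZFSet.mem_insert_iff.1 hz with rfl | hz
    exacts [ha, hA.subset_of_mem hs hz]
  · refine ((NatDefinable.eq_param () ⟨a, ha⟩).or (NatDefinable.exists_elem
      (P := fun u c _ => c = ⟨s, hs⟩ ∧ (u ()).1 ∈ c.1)
      ((NatDefinable.eq_param none _).and (natDefinable_mem (some ()) none)))).congr fun u w => ?_
    simp [ZFSet.mem_insert_iff, Subtype.ext_iff]

theorem subset_defPowerset (hA : A.IsTransitive) : A ⊆ defPowerset A := by
  intro s hs
  refine mem_defPowerset_of_natDefinable (e := fun _ => ⟨s, hs⟩) (hA.subset_of_mem hs) ?_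
  refine (NatDefinable.exists_elem (P := fun u c _ => c = ⟨s, hs⟩ ∧ (u ()).1 ∈ c.1)
      ((NatDefinable.eq_param none _).and (natDefinable_mem (some ()) none))).congr fun u w => ?_
  simp

theorem defPowerset_subset_powerset : defPowerset A ⊆ ZFSet.powerset A := ZFSet.sep_subset

end TransitiveSet

/-! ### Basic properties of the constructible hierarchy -/

section Constructible

theorem isTransitive_constructibleLevel (α : Ordinal.{u}) :
    (constructibleLevel α).IsTransitive := by
  induction α using Ordinal.limitRecOn with
  | zero =>
    rw [constructibleLevel_zero]
    exact ZFSet.isTransitive_empty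
  | add_one β ih =>
    rw [constructibleLevel_add_one]
    intro s hs t ht
    exact subset_defPowerset ih (ZFSet.mem_powerset.1 (defPowerset_subset_powerset hs) ht)
  | limit β hβ ih =>
    rw [constructibleLevel_limit β hβ]
    exact ZFSet.IsTransitive.iUnion fun γ => ih γ.1 γ.2

theorem constructibleLevel_mono {α β : Ordinal.{u}} (h : α ≤ β) :
    constructibleLevel α ⊆ constructibleLevel β := by
  induction β using Ordinal.limitRecOn with
  | zero => rw [nonpos_iff_eq_zero.1 h]
  | add_one β ih =>
    rcases h.eq_or_lt with rfl | h
    · rfl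
    · rw [constructibleLevel_add_one]
      exact (ih (Order.lt_add_one_iff.1 h)).trans
        (subset_defPowerset (isTransitive_constructibleLevel β))
  | limit β hβ ih =>
    rcases h.eq_or_lt with rfl | h
    · rfl
    · rw [constructibleLevel_limit β hβ]
      exact ZFSet.subset_iUnion (fun γ : Set.Iio β => constructibleLevel γ.1) ⟨α, h⟩

theorem rank_lt_of_mem_constructibleLevel {α : Ordinal.{u}} {z : ZFSet.{u}}
    (hz : z ∈ constructibleLevel α) : z.rank < α := by
  induction α using Ordinal.limitRecOn generalizing z with
  | zero => simp [constructibleLevel_zero] at hz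
  | add_one β ih =>
    rw [constructibleLevel_add_one] at hz
    rw [Order.lt_add_one_iff, ZFSet.rank_le_iff]
    exact fun y hy => ih (ZFSet.mem_powerset.1 (defPowerset_subset_powerset hz) hy)
  | limit β hβ ih =>
    rw [constructibleLevel_limit β hβ, ZFSet.mem_iUnion] at hz
    obtain ⟨γ, hγ⟩ := hz
    exact (ih γ.1 γ.2 hγ).trans γ.2

theorem mem_constructibleLevel_omega0 {z : ZFSet.{u}} :
    z ∈ constructibleLevel Ordinal.omega0 ↔ ∃ n : ℕ, z ∈ constructibleLevel (n : Ordinal.{u}) := by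
  rw [constructibleLevel_limit _ Ordinal.isSuccLimit_omega0, ZFSet.mem_iUnion]
  constructor
  · rintro ⟨⟨γ, hγ⟩, h⟩
    obtain ⟨n, rfl⟩ := Ordinal.lt_omega0.1 hγ
    exact ⟨n, h⟩
  · rintro ⟨n, h⟩
    exact ⟨⟨n, Ordinal.natCast_lt_omega0 n⟩, h⟩

/-! ### Hereditarily finite sets in `L_ω`. -/

theorem empty_mem_constructibleLevel_omega0 : ∅ ∈ constructibleLevel.{u} Ordinal.omega0 := by
  refine mem_constructibleLevel_omega0.2 ⟨1, ?_⟩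
  rw [Nat.cast_one, ← zero_add 1, constructibleLevel_add_one, constructibleLevel_zero]
  exact ZFSet.mem_sep.2 ⟨ZFSet.mem_powerset.2 (fun _ h => h), by
    rw [Set.Definable₁]
    convert Set.definable_empty
    ext v
    exact iff_of_false (ZFSet.notMem_empty _) id⟩

theorem insert_mem_constructibleLevel_omega0 {a s : ZFSet.{u}}
    (ha : a ∈ constructibleLevel.{u} Ordinal.omega0)
    (hs : s ∈ constructibleLevel.{u} Ordinal.omega0) :
    insert a s ∈ constructibleLevel.{u} Ordinal.omega0 := by
  rw [mem_constructibleLevel_omega0] at ha hs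
  obtain ⟨m, ha⟩ := ha
  obtain ⟨n, hs⟩ := hs
  refine mem_constructibleLevel_omega0.2 ⟨max m n + 1, ?_⟩
  rw [Nat.cast_succ, constructibleLevel_add_one]
  exact insert_mem_defPowerset (isTransitive_constructibleLevel _)
    (constructibleLevel_mono (by simp) ha) (constructibleLevel_mono (by simp) hs)

theorem singleton_mem_constructibleLevel_omega0 {a : ZFSet.{u}}
    (ha : a ∈ constructibleLevel.{u} Ordinal.omega0) :
    {a} ∈ constructibleLevel.{u} Ordinal.omega0 := by
  have := insert_mem_constructibleLevel_omega0 ha empty_mem_constructibleLevel_omega0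
  rwa [LawfulSingleton.insert_empty_eq] at this

theorem pair_mem_constructibleLevel_omega0 {a b : ZFSet.{u}}
    (ha : a ∈ constructibleLevel.{u} Ordinal.omega0)
    (hb : b ∈ constructibleLevel.{u} Ordinal.omega0) :
    ZFSet.pair a b ∈ constructibleLevel.{u} Ordinal.omega0 :=
  insert_mem_constructibleLevel_omega0 (singleton_mem_constructibleLevel_omega0 ha)
    (singleton_mem_constructibleLevel_omega0
      (insert_mem_constructibleLevel_omega0 ha (singleton_mem_constructibleLevel_omega0 hb)))

theorem toZFSet_natCast_mem_constructibleLevel_omega0 (n : ℕ) :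
    Ordinal.toZFSet (n : Ordinal.{u}) ∈ constructibleLevel.{u} Ordinal.omega0 := by
  induction n with
  | zero => simpa using empty_mem_constructibleLevel_omega0
  | succ n ih =>
    rw [Nat.cast_succ, Ordinal.toZFSet_add_one]
    exact insert_mem_constructibleLevel_omega0 ih ih

theorem toZFSet_natCast_injective :
    Function.Injective (fun n : ℕ => Ordinal.toZFSet (n : Ordinal.{u})) :=
  Ordinal.toZFSet_injective.comp Nat.cast_injective

theorem exists_mem_constructibleLevel_omega0_of_finset (F : Finset (ℕ × ℕ)) :
    ∃ c ∈ constructibleLevel.{u} Ordinal.omega0, ∀ i a : ℕ,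
      ZFSet.pair (Ordinal.toZFSet (i : Ordinal.{u})) (Ordinal.toZFSet (a : Ordinal.{u})) ∈ c ↔
        (i, a) ∈ F := by
  classical
  induction F using Finset.induction_on with
  | empty => exact ⟨∅, empty_mem_constructibleLevel_omega0, by simp⟩
  | insert p F _ ih =>
    obtain ⟨c, hc, h⟩ := ih
    refine ⟨_, insert_mem_constructibleLevel_omega0 (pair_mem_constructibleLevel_omega0
      (toZFSet_natCast_mem_constructibleLevel_omega0 p.1)
      (toZFSet_natCast_mem_constructibleLevel_omega0 p.2)) hc, fun i a => ?_⟩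
    rw [ZFSet.mem_insert_iff, h, ZFSet.pair_inj, toZFSet_natCast_injective.eq_iff,
      toZFSet_natCast_injective.eq_iff, Finset.mem_insert, Prod.ext_iff]

/-! ### Arithmetic inside `L_α`. -/

theorem pair_mem_baireSet {f : ℕ → ℕ} {a b : ZFSet.{u}} :
    ZFSet.pair a b ∈ baireSet.{u} f ↔ ∃ n : ℕ, a = Ordinal.toZFSet (n : Ordinal.{u}) ∧
      b = Ordinal.toZFSet ((f n : ℕ) : Ordinal.{u}) := by
  simp [baireSet, ZFSet.pair_inj, eq_comm]

/-- The graph has a pair with first coordinate `n` for every `n`, so its rank exceeds every natural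
number. -/
theorem omega0_le_of_inLevel {α : Ordinal.{u}} {f : ℕ → ℕ} (hf : InLevel α f) :
    Ordinal.omega0 ≤ α := by
  rw [Ordinal.omega0_le]
  intro n
  have h : ZFSet.pair (Ordinal.toZFSet (n : Ordinal.{u})) (Ordinal.toZFSet ((f n : ℕ) : Ordinal.{u}))
      ∈ baireSet.{u} f := pair_mem_baireSet.2 ⟨n, rfl, rfl⟩
  have h1 := ZFSet.rank_lt_of_mem h
  have h2 : Ordinal.toZFSet (n : Ordinal.{u}) ∈ ({Ordinal.toZFSet (n : Ordinal.{u})} : ZFSet.{u}) :=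
    by simp
  have h3 : ({Ordinal.toZFSet (n : Ordinal.{u})} : ZFSet.{u}) ∈
    ZFSet.pair (Ordinal.toZFSet (n : Ordinal.{u})) (Ordinal.toZFSet ((f n : ℕ) : Ordinal.{u})) := by
    simp [ZFSet.pair]
  have h4 := ((ZFSet.rank_lt_of_mem h2).trans (ZFSet.rank_lt_of_mem h3)).trans h1
  rw [Ordinal.rank_toZFSet] at h4
  exact (h4.trans (rank_lt_of_mem_constructibleLevel hf)).le

/-- The natural number `n` as an element of `L_α`. -/
noncomputable def levelNat {α : Ordinal.{u}} (hα : Ordinal.omega0 ≤ α) (n : ℕ) :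
    {z : ZFSet.{u} // z ∈ constructibleLevel α} :=
  ⟨Ordinal.toZFSet (n : Ordinal.{u}),
    constructibleLevel_mono hα (toZFSet_natCast_mem_constructibleLevel_omega0 n)⟩

theorem natCoding_levelNat {α : Ordinal.{u}} (hα : Ordinal.omega0 ≤ α) {f : ℕ → ℕ}
    (hf : InLevel α f) :
    NatCoding LST (levelNat hα) (fun c i a => ZFSet.pair i.1 a.1 ∈ c.1) where
  injective m n h := toZFSet_natCast_injective (congrArg Subtype.val h)
  range := by
    -- The numbers are defined as the domain of the parameter `f`.
    refine NatDefinable.definable (e := levelNat hα) ((NatDefinable.exists_elem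
      (P := fun (u : Unit → {z // z ∈ constructibleLevel α}) a _ =>
        ZFSet.pair (u ()).1 a.1 ∈ baireSet f) (natDefinable_pair_mem_param
          (isTransitive_constructibleLevel α) (some ()) none hf)).congr fun u w => ?_)
    simp only [pair_mem_baireSet]
    constructor
    · rintro ⟨a, n, h, -⟩
      exact ⟨n, Subtype.ext h.symm⟩
    · rintro ⟨n, h⟩
      exact ⟨levelNat hα (f n), n, (congrArg Subtype.val h).symm, rfl⟩
  succ := by
    have h : NatDefinable LST (levelNat hα)
        (fun (u : Empty ⊕ Bool → {z // z ∈ constructibleLevel α}) (_ : Empty → ℕ) =>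
          ∀ c : {z // z ∈ constructibleLevel α}, c.1 ∈ (u (Sum.inr true)).1 ↔
            c.1 ∈ (u (Sum.inr false)).1 ∨ c = u (Sum.inr false)) :=
      NatDefinable.forall_elem
        (P := fun (u : Empty ⊕ Bool → {z // z ∈ constructibleLevel α})
            (c : {z // z ∈ constructibleLevel α}) _ => c.1 ∈ (u (Sum.inr true)).1 ↔
            c.1 ∈ (u (Sum.inr false)).1 ∨ c = u (Sum.inr false))
        ((natDefinable_mem none (some (Sum.inr true))).iff
          ((natDefinable_mem none (some (Sum.inr false))).or
          (.eq_elem none (some (Sum.inr false)))))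
    refine h.elim.congr fun _ w => ?_
    have key : ∀ n : ℕ, Ordinal.toZFSet ((n + 1 : ℕ) : Ordinal.{u}) =
        insert (Ordinal.toZFSet (n : Ordinal.{u})) (Ordinal.toZFSet (n : Ordinal.{u})) := by
      intro n
      rw [Nat.cast_succ, Ordinal.toZFSet_add_one]
    constructor
    · intro h
      refine toZFSet_natCast_injective ?_
      change Ordinal.toZFSet _ = Ordinal.toZFSet _
      rw [key]
      ext z
      rw [ZFSet.mem_insert_iff]
      have hA := isTransitive_constructibleLevel α
      constructor
      · intro hz
        have := (h ⟨z, hA.subset_of_mem (levelNat hα (w true)).2 hz⟩).1 hz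
        simpa [Subtype.ext_iff, levelNat, or_comm] using this
      · rintro (rfl | hz)
        · exact (h (levelNat hα (w false))).2 (Or.inr rfl)
        · exact (h ⟨z, hA.subset_of_mem (levelNat hα (w false)).2 hz⟩).2 (Or.inl hz)
    · intro h c
      simp only [Sum.elim_inr, Function.comp, levelNat, h, key, ZFSet.mem_insert_iff, Subtype.ext_iff]
      exact or_comm
  definable_app := (natDefinable_pair_mem (e := levelNat hα) (κ := Empty)
    (isTransitive_constructibleLevel α) (1 : Fin 3) 2 0).definable
  exists_code F := by
    obtain ⟨c, hc, h⟩ := exists_mem_constructibleLevel_omega0_of_finset.{u} F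
    exact ⟨⟨c, constructibleLevel_mono hα hc⟩, h⟩

theorem arithFun_of_inLevel {α : Ordinal.{u}} (hα : Ordinal.omega0 ≤ α) {f : ℕ → ℕ}
    (hf : InLevel α f) : ArithFun LST (levelNat hα) f := by
  have hc := natCoding_levelNat hα hf
  have h : NatDefinable LST (levelNat hα)
      (fun (u : Empty ⊕ Bool → {z // z ∈ constructibleLevel α}) (_ : Empty → ℕ) =>
        ZFSet.pair (u (Sum.inr false)).1 (u (Sum.inr true)).1 ∈ baireSet f) :=
    natDefinable_pair_mem_param (isTransitive_constructibleLevel α) _ _ hf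
  have hfst : Primrec (fun n : ℕ => n.unpair.1) := Primrec.fst.comp Primrec.unpair
  have hsnd : Primrec (fun n : ℕ => n.unpair.2) := Primrec.snd.comp Primrec.unpair
  refine (NatDefinable.subst hc h.elim
    (f := fun b (w : Unit → ℕ) => cond b (w ()).unpair.2 (w ()).unpair.1) ?_).congr fun _ w => ?_
  · rintro (_ | _)
    exacts [.of_primrec hc hfst, .of_primrec hc hsnd]
  · simp only [Sum.elim_inr, Function.comp, levelNat, pair_mem_baireSet, cond_true, cond_false]
    constructor
    · rintro ⟨n, h1, h2⟩
      have h1 := toZFSet_natCast_injective h1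
      have h2 := toZFSet_natCast_injective h2
      exact ⟨((w ()).unpair.1, (w ()).unpair.2), by simp, by simp only [h1, h2]⟩
    · rintro ⟨p, hp, h⟩
      simp only [Encodable.decode_prod_val, Encodable.decode_nat, Option.bind_some, Option.map_some,
        Option.some.injEq] at hp
      subst hp
      exact ⟨_, rfl, by rw [h]⟩

/-- The graph of `f` is a subset of `L_α`, since `L_ω` is closed under pairs, and it is definable
there. The real `g` only supplies the coding of arithmetic. -/
theorem inLevel_add_one_of_arithFun {α : Ordinal.{u}} (hα : Ordinal.omega0 ≤ α) {f g : ℕ → ℕ}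
    (hg : InLevel α g) (hf : ArithFun LST (levelNat hα) f) : InLevel (α + 1) f := by
  have hc := natCoding_levelNat hα hg
  have h1 : NatDefinable LST (levelNat hα) (fun (_ : Empty → {z // z ∈ constructibleLevel α})
      (w : Option Unit → ℕ) => f (w (some ())) = w none) :=
    (NatDefinable.subst hc hf (fun _ => NatDefinableFun.natPair hc)).congr fun _ w => by simp
  have h2 : NatDefinable LST (levelNat hα)
      (fun (u : Unit ⊕ Option Unit → {z // z ∈ constructibleLevel α}) (_ : Empty → ℕ) =>
        (u (Sum.inl ())).1 = ZFSet.pair (u (Sum.inr (some ()))).1 (u (Sum.inr none)).1) :=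
    natDefinable_eq_pair (isTransitive_constructibleLevel α) _ _ _
  have h3 := NatDefinable.exists_nats hc (κ := Empty) (P := fun u _ w => f (w (some ())) = w none ∧
    (u ()).1 = ZFSet.pair (levelNat hα (w (some ()))).1 (levelNat hα (w none)).1)
    (((h1.reindex Empty.elim id).and h2.elim).reindex id Sum.inr)
  rw [InLevel, constructibleLevel_add_one]
  refine mem_defPowerset_of_natDefinable (e := levelNat hα) ?_ (h3.congr fun u w => ?_)
  · intro z hz
    obtain ⟨n, rfl⟩ := ZFSet.mem_range.1 hz
    exact constructibleLevel_mono hα (pair_mem_constructibleLevel_omega0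
      (toZFSet_natCast_mem_constructibleLevel_omega0 n)
      (toZFSet_natCast_mem_constructibleLevel_omega0 _))
  · simp only [baireSet, ZFSet.mem_range]
    constructor
    · rintro ⟨w', h, h'⟩
      exact ⟨w' (some ()), by rw [h', h]; rfl⟩
    · rintro ⟨n, h⟩
      exact ⟨fun o => o.elim (f n) fun _ => n, rfl, h.symm⟩

end Constructible

/-! ### Binary expansions -/

section Dyadic

/-- The natural number with binary digits `g 2, …, g (N + 1)`. -/
def dyadicSum (g : ℕ → ℕ) (N : ℕ) : ℕ := Nat.rec 0 (fun i z => 2 * z + g (i + 2)) N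

theorem dyadicSum_succ (g : ℕ → ℕ) (N : ℕ) :
    dyadicSum g (N + 1) = 2 * dyadicSum g N + g (N + 2) := rfl

theorem sum_range_div_two_pow (g : ℕ → ℕ) (N : ℕ) :
    ∑ i ∈ Finset.range N, (g (i + 2) : ℝ) / 2 ^ (i + 1) = dyadicSum g N / 2 ^ N := by
  induction N with
  | zero => simp [dyadicSum]
  | succ N ih =>
    rw [Finset.sum_range_succ, ih, dyadicSum_succ]
    push_cast
    field_simp
    ring

theorem CodesReal.le {g : ℕ → ℕ} {r : ℝ} (h : CodesReal g r) (N : ℕ) :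
    (g 0 : ℝ) - g 1 + dyadicSum g N / 2 ^ N ≤ r := by
  have := sum_le_hasSum (Finset.range N) (fun i _ => by positivity) h.2
  rw [sum_range_div_two_pow] at this
  linarith

theorem CodesReal.ge {g : ℕ → ℕ} {r : ℝ} (h : CodesReal g r) (N : ℕ) :
    r ≤ (g 0 : ℝ) - g 1 + (dyadicSum g N + 1) / 2 ^ N := by
  have h1 := (hasSum_nat_add_iff' N).2 h.2
  rw [sum_range_div_two_pow] at h1
  have h2 := hasSum_geometric_two' (1 / 2 ^ N : ℝ)
  -- All remaining digits are at most `1`, so the tail is dominated by a geometric series with sum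
  -- `1 / 2 ^ N`.
  have h3 : ∀ i, (g (i + N + 2) : ℝ) / 2 ^ (i + N + 1) ≤ 1 / 2 ^ N / 2 / 2 ^ i := by
    intro i
    have : (g (i + N + 2) : ℝ) ≤ 1 := by exact_mod_cast h.1 (i + N)
    calc (g (i + N + 2) : ℝ) / 2 ^ (i + N + 1) ≤ 1 / 2 ^ (i + N + 1) := by gcongr
      _ = 1 / 2 ^ N / 2 / 2 ^ i := by field_simp; ring
  have h4 := hasSum_le h3 h1 h2
  rw [add_div]
  linarith

theorem exists_codesReal {g : ℕ → ℕ} (h : ∀ m, g (m + 2) ≤ 1) : ∃ r, CodesReal g r := by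
  have hs : Summable (fun m : ℕ => (g (m + 2) : ℝ) / 2 ^ (m + 1)) := by
    refine Summable.of_nonneg_of_le (fun _ => by positivity) (fun m => ?_)
      (hasSum_geometric_two' 1).summable
    have : (g (m + 2) : ℝ) ≤ 1 := by exact_mod_cast h m
    rw [div_div, ← pow_succ']
    gcongr
  refine ⟨(∑' m : ℕ, (g (m + 2) : ℝ) / 2 ^ (m + 1)) + ((g 0 : ℝ) - g 1), h, ?_⟩
  rw [add_sub_cancel_right]
  exact hs.hasSum

end Dyadic

/-! ### Nested dyadic intervals -/

section Nested

/-- The number `e = ⟨a, l⟩` stands for the interval `[a / 2 ^ l, (a + 1) / 2 ^ l]`. The interval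
`e'` is shorter than `e` and contained in it. -/
def Refines (e e' : ℕ) : Prop :=
  e.unpair.2 < e'.unpair.2 ∧ e.unpair.1 * 2 ^ e'.unpair.2 ≤ e'.unpair.1 * 2 ^ e.unpair.2 ∧
    (e'.unpair.1 + 1) * 2 ^ e.unpair.2 ≤ (e.unpair.1 + 1) * 2 ^ e'.unpair.2

/-- The digits of the number in all the intervals `E k`, where `E k` is shorter than `2 ^ (-k)`. -/
def digitPrefix (E : ℕ → ℕ) (N : ℕ) : ℕ := (E N).unpair.1 / 2 ^ ((E N).unpair.2 - N)

/-- A code of the number in all the intervals `E k`. -/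
def digitCode (E : ℕ → ℕ) (i : ℕ) : ℕ := if i < 2 then 0 else digitPrefix E (i - 1) % 2

/-- Containment of dyadic intervals means that the shorter one's numerator extends the longer one's
by further binary digits. -/
theorem Refines.div_eq {e e' : ℕ} (h : Refines e e') :
    e'.unpair.1 / 2 ^ (e'.unpair.2 - e.unpair.2) = e.unpair.1 := by
  obtain ⟨h1, h2, h3⟩ := h
  obtain ⟨t, ht⟩ := Nat.exists_eq_add_of_lt h1
  rw [ht] at h2 h3 ⊢
  have hp : 0 < 2 ^ e.unpair.2 := by positivity
  rw [show e.unpair.2 + t + 1 - e.unpair.2 = t + 1 by omega]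
  rw [show e.unpair.2 + t + 1 = (t + 1) + e.unpair.2 by omega, pow_add, ← mul_assoc] at h2 h3
  have h2 := Nat.le_of_mul_le_mul_right h2 hp
  have h3 := Nat.le_of_mul_le_mul_right h3 hp
  refine Nat.div_eq_of_lt_le h2 (by omega)

variable {E : ℕ → ℕ}

theorem le_unpair_snd (hE : ∀ k, Refines (E k) (E (k + 1))) (k : ℕ) : k ≤ (E k).unpair.2 := by
  induction k with
  | zero => exact Nat.zero_le _
  | succ k ih => exact ih.trans_lt (hE k).1

theorem unpair_snd_mono (hE : ∀ k, Refines (E k) (E (k + 1))) : Monotone fun k => (E k).unpair.2 :=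
  monotone_nat_of_le_succ fun k => (hE k).1.le

theorem div_two_pow_eq (hE : ∀ k, Refines (E k) (E (k + 1))) {k k' : ℕ} (h : k ≤ k') :
    (E k').unpair.1 / 2 ^ ((E k').unpair.2 - (E k).unpair.2) = (E k).unpair.1 := by
  induction k', h using Nat.le_induction with
  | base => simp
  | succ k' h ih =>
    have h1 := unpair_snd_mono hE h
    have h2 := (hE k').1
    dsimp only at h1
    rw [show (E (k' + 1)).unpair.2 - (E k).unpair.2 = ((E (k' + 1)).unpair.2 - (E k').unpair.2) +
      ((E k').unpair.2 - (E k).unpair.2) by omega, pow_add, ← Nat.div_div_eq_div_mul,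
      (hE k').div_eq, ih]

theorem digitPrefix_eq_div (hE : ∀ k, Refines (E k) (E (k + 1))) {N k : ℕ} (h : N ≤ k) :
    digitPrefix E N = (E k).unpair.1 / 2 ^ ((E k).unpair.2 - N) := by
  have h1 := unpair_snd_mono hE h
  have h2 := le_unpair_snd hE N
  dsimp only at h1
  rw [digitPrefix, ← div_two_pow_eq hE h, Nat.div_div_eq_div_mul, ← pow_add]
  congr 2
  omega

theorem digitPrefix_succ_div_two (hE : ∀ k, Refines (E k) (E (k + 1))) (N : ℕ) :
    digitPrefix E (N + 1) / 2 = digitPrefix E N := by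
  have h2 := le_unpair_snd hE (N + 1)
  rw [digitPrefix_eq_div hE (show N ≤ N + 1 by omega), digitPrefix, Nat.div_div_eq_div_mul, ← pow_succ]
  congr 2
  omega

theorem digitPrefix_unpair_snd (hE : ∀ k, Refines (E k) (E (k + 1))) (k : ℕ) :
    digitPrefix E (E k).unpair.2 = (E k).unpair.1 :=
  div_two_pow_eq hE (le_unpair_snd hE k)

theorem dyadicSum_digitCode (hE : ∀ k, Refines (E k) (E (k + 1))) (h0 : E 0 = 0) (N : ℕ) :
    dyadicSum (digitCode E) N = digitPrefix E N := by
  induction N with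
  | zero => simp [dyadicSum, digitPrefix, h0]
  | succ N ih =>
    rw [dyadicSum_succ, ih, ← digitPrefix_succ_div_two hE N]
    -- Entry `N + 2` of the code is the last bit of the prefix of length `N + 1`, because entries
    -- `0` and `1` hold the integer part.
    simp only [digitCode, show ¬ N + 2 < 2 by omega, if_false,
      show N + 2 - 1 = N + 1 from rfl]
    exact Nat.div_add_mod _ 2

theorem exists_codesReal_digitCode (hE : ∀ k, Refines (E k) (E (k + 1))) (h0 : E 0 = 0) :
    ∃ c, CodesReal (digitCode E) c ∧ ∀ k,
    ((E k).unpair.1 : ℝ) / 2 ^ (E k).unpair.2 ≤ c ∧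
      c ≤ ((E k).unpair.1 + 1 : ℝ) / 2 ^ (E k).unpair.2 := by
  obtain ⟨c, hc⟩ := exists_codesReal (g := digitCode E) fun m => by
    simp only [digitCode, show ¬ m + 2 < 2 by omega, if_false]
    omega
  refine ⟨c, hc, fun k => ?_⟩
  have h1 := hc.le (E k).unpair.2
  -- Truncating at the exponent of `E k` recovers exactly its numerator, so the truncation bounds
  -- are its endpoints.
  have h2 := hc.ge (E k).unpair.2
  rw [dyadicSum_digitCode hE h0, digitPrefix_unpair_snd hE] at h1 h2
  simp only [digitCode, show 0 < 2 by omega, show 1 < 2 by omega, if_true, Nat.cast_zero,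
    sub_self, zero_add] at h1 h2
  exact ⟨h1, h2⟩

end Nested

/-! ### A generic real number -/

section Generic

/-- The interval `[g0 - g1 + D / 2 ^ l, g0 - g1 + (D + 2) / 2 ^ l]` is contained in `I_j`. -/
def InRatInterval (j g0 g1 D l : ℕ) : Prop :=
  j.unpair.1.unpair.1 * 2 ^ l + (j.unpair.2.unpair.1 + 1) * (g1 * 2 ^ l) <
      j.unpair.1.unpair.2 * 2 ^ l + (j.unpair.2.unpair.1 + 1) * (g0 * 2 ^ l + D) ∧
    j.unpair.1.unpair.2 * 2 ^ l + (j.unpair.2.unpair.1 + 1) * (g0 * 2 ^ l + D + 2) <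
      (j.unpair.1.unpair.1 + j.unpair.2.unpair.2 + 1) * 2 ^ l +
        (j.unpair.2.unpair.1 + 1) * (g1 * 2 ^ l)

/-- Multiply by `(d + 1) * 2 ^ l` and move negative terms across; this keeps the test within `ℕ`. -/
theorem inRatInterval_iff {j g0 g1 D l : ℕ} : InRatInterval j g0 g1 D l ↔
    leftEnd j < (g0 : ℝ) - g1 + D / 2 ^ l ∧ (g0 : ℝ) - g1 + (D + 2) / 2 ^ l < rightEnd j := by
  have h2 : (0 : ℝ) < 2 ^ l := by positivity
  have hd : (0 : ℝ) < (j.unpair.2.unpair.1 : ℝ) + 1 := by positivity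
  rw [InRatInterval, rightEnd, leftEnd, ← add_div, div_lt_iff₀ hd, lt_div_iff₀ hd]
  refine and_congr ?_ ?_
  · rw [← Nat.cast_lt (α := ℝ)]
    refine Iff.trans ?_ (mul_lt_mul_iff_left₀ h2)
    push_cast
    have : ((g0 : ℝ) - g1 + D / 2 ^ l) * (j.unpair.2.unpair.1 + 1) * 2 ^ l =
      (j.unpair.2.unpair.1 + 1) * ((g0 - g1) * 2 ^ l + D) := by field_simp
    rw [this]
    constructor <;> intro h <;> linarith
  · rw [← Nat.cast_lt (α := ℝ)]
    refine Iff.trans ?_ (mul_lt_mul_iff_left₀ h2)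
    push_cast
    have : ((g0 : ℝ) - g1 + (D + 2) / 2 ^ l) * (j.unpair.2.unpair.1 + 1) * 2 ^ l =
      (j.unpair.2.unpair.1 + 1) * ((g0 - g1) * 2 ^ l + D + 2) := by field_simp; ring
    rw [this]
    constructor <;> intro h <;> linarith

/-- The interval `e'` refines `e`, and for `k = ⟨m, n⟩` its translate by the real number with code
`proj y m` is contained in one of the intervals that make up the open set with code `proj x n`. -/
def StepRel (x y : ℕ → ℕ) (k e e' : ℕ) : Prop :=
  Refines e e' ∧ ∃ j, proj x k.unpair.2 j = 1 ∧
    InRatInterval j (proj y k.unpair.1 0) (proj y k.unpair.1 1)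
      (dyadicSum (proj y k.unpair.1) e'.unpair.2 + e'.unpair.1) e'.unpair.2

/-- The truncated code of `r` and the dyadic interval of `c` each leave an uncertainty of `1 / 2 ^
l`, which accounts for the length `2 / 2 ^ l` in `InRatInterval`. -/
theorem StepRel.add_mem {x y : ℕ → ℕ} {k e e' : ℕ} (h : StepRel x y k e e') {r c : ℝ}
    (hr : CodesReal (proj y k.unpair.1) r) (h1 : (e'.unpair.1 : ℝ) / 2 ^ e'.unpair.2 ≤ c)
    (h2 : c ≤ (e'.unpair.1 + 1 : ℝ) / 2 ^ e'.unpair.2) :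
    r + c ∈ openOfCode (proj x k.unpair.2) := by
  obtain ⟨-, j, hj, h⟩ := h
  obtain ⟨h3, h4⟩ := inRatInterval_iff.1 h
  have h5 := hr.le e'.unpair.2
  have h6 := hr.ge e'.unpair.2
  push_cast at h3 h4
  simp only [add_div] at h2 h3 h4 h6
  refine Set.mem_biUnion (x := j) hj ⟨by linarith, ?_⟩
  have : (2 : ℝ) / 2 ^ e'.unpair.2 = 1 / 2 ^ e'.unpair.2 + 1 / 2 ^ e'.unpair.2 := by ring
  linarith

theorem exists_stepRel {x y : ℕ → ℕ} {k : ℕ} {r : ℝ} (hr : CodesReal (proj y k.unpair.1) r)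
    (hx : Set.range ((↑) : ℚ → ℝ) ⊆ openOfCode (proj x k.unpair.2)) (e : ℕ) :
    ∃ e', StepRel x y k e e' := by
  set a := e.unpair.1 with ha
  set l := e.unpair.2 with hl
  have hpos : (0 : ℝ) < 2 ^ l := by positivity
  have hlt : r + a / 2 ^ l < r + (a + 1) / 2 ^ l := by gcongr; linarith
  obtain ⟨z, hz1, hz2⟩ := exists_rat_btwn hlt
  obtain ⟨j, hj, hzl, hzr⟩ : ∃ j, proj x k.unpair.2 j = 1 ∧ leftEnd j < z ∧
      (z : ℝ) < rightEnd j := by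
    have := hx ⟨z, rfl⟩
    simpa [openOfCode, ratInterval, and_left_comm] using this
  -- An interval of length `2 / 2 ^ t` around `z` then stays inside `I_j`.
  obtain ⟨t, ht⟩ : ∃ t : ℕ, (2 : ℝ) / 2 ^ t < min (z - leftEnd j) (rightEnd j - z) := by
    have hm : 0 < min ((z : ℝ) - leftEnd j) (rightEnd j - z) := by
      simp only [lt_min_iff]
      constructor <;> linarith
    obtain ⟨t, ht⟩ := exists_pow_lt_of_lt_one (half_pos hm) (show (1 / 2 : ℝ) < 1 by norm_num)
    refine ⟨t, ?_⟩
    rw [one_div, inv_pow] at ht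
    rw [div_eq_mul_inv]
    linarith
  -- The extra `1` makes the new interval strictly shorter, even if `t = 0`.
  set N := l + (t + 1) with hN
  have hNpos : (0 : ℝ) < 2 ^ N := by positivity
  have hNt : (2 : ℝ) / 2 ^ N ≤ 2 / 2 ^ t := by
    gcongr
    · norm_num
    · omega
  obtain ⟨ht1, ht2⟩ := lt_min_iff.1 (hNt.trans_lt ht)
  set s : ℝ := z - r with hs
  have hs1 : (a : ℝ) / 2 ^ l < s := by linarith
  have hs2 : s < (a + 1) / 2 ^ l := by linarith
  have hs0 : 0 ≤ s := le_trans (by positivity) hs1.le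
  have hle := Nat.floor_le (show 0 ≤ s * 2 ^ N by positivity)
  have hge := Nat.lt_floor_add_one (s * 2 ^ N)
  -- The new interval is the dyadic cell of level `N` containing `z - r`.
  set a' := ⌊s * 2 ^ N⌋₊ with ha'
  have h1 : a * 2 ^ (t + 1) ≤ a' := by
    refine Nat.le_floor ?_
    rw [div_lt_iff₀ hpos] at hs1
    push_cast
    rw [hN, pow_add _ l, ← mul_assoc]
    gcongr
  have h2 : a' < (a + 1) * 2 ^ (t + 1) := by
    refine (Nat.floor_lt (by positivity)).2 ?_
    rw [lt_div_iff₀ hpos] at hs2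
    push_cast
    rw [hN, pow_add _ l, ← mul_assoc]
    gcongr
  refine ⟨Nat.pair a' N, ⟨?_, ?_, ?_⟩, j, hj, ?_⟩
  · rw [Nat.unpair_pair]
    omega
  · rw [Nat.unpair_pair, ← ha, ← hl]
    dsimp only
    rw [hN, add_comm l, pow_add, ← mul_assoc]
    exact Nat.mul_le_mul_right _ h1
  · rw [Nat.unpair_pair, ← ha, ← hl]
    dsimp only
    rw [hN, add_comm l, pow_add, ← mul_assoc]
    exact Nat.mul_le_mul_right _ h2
  · rw [Nat.unpair_pair, inRatInterval_iff]
    dsimp only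
    have h5 := hr.le N
    have h6 := hr.ge N
    rw [← div_le_iff₀ hNpos] at hle
    rw [← lt_div_iff₀ hNpos] at hge
    push_cast
    simp only [add_div] at h6 hge ⊢
    have : (2 : ℝ) / 2 ^ N = 1 / 2 ^ N + 1 / 2 ^ N := by ring
    constructor <;> linarith

/-- A nested sequence of dyadic intervals, each step of which is the first possible one. -/
noncomputable def stepSeq (x y : ℕ → ℕ) (k : ℕ) : ℕ :=
  Nat.rec 0 (fun i e => sInf {e' | StepRel x y i e e'}) k

end Generic

/-! ### Definability of the construction from `x` and `y`. -/

section Definability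

theorem primrec_two_pow : Primrec (fun n : ℕ => 2 ^ n) := by
  refine (Primrec.nat_rec₁ 1 (Primrec.nat_mul.comp₂ (Primrec₂.const 2) Primrec₂.right)).of_eq
    fun n => ?_
  induction n with
  | zero => rfl
  | succ n ih => rw [pow_succ', ← ih]

theorem primrec_unpair_fst : Primrec (fun n : ℕ => n.unpair.1) := Primrec.fst.comp Primrec.unpair

theorem primrec_unpair_snd : Primrec (fun n : ℕ => n.unpair.2) := Primrec.snd.comp Primrec.unpair

theorem primrecPred_refines : PrimrecPred (fun p : ℕ × ℕ => Refines p.1 p.2) := by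
  have a := primrec_unpair_fst.comp (Primrec.fst (α := ℕ) (β := ℕ))
  have l := primrec_two_pow.comp (primrec_unpair_snd.comp (Primrec.fst (α := ℕ) (β := ℕ)))
  have a' := primrec_unpair_fst.comp (Primrec.snd (α := ℕ) (β := ℕ))
  have l' := primrec_two_pow.comp (primrec_unpair_snd.comp (Primrec.snd (α := ℕ) (β := ℕ)))
  exact (Primrec.nat_lt.comp (primrec_unpair_snd.comp Primrec.fst)
    (primrec_unpair_snd.comp Primrec.snd)).and
    ((Primrec.nat_le.comp (Primrec.nat_mul.comp a l') (Primrec.nat_mul.comp a' l)).and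
    (Primrec.nat_le.comp (Primrec.nat_mul.comp (Primrec.succ.comp a') l)
      (Primrec.nat_mul.comp (Primrec.succ.comp a) l')))

theorem primrecPred_inRatInterval : PrimrecPred (fun p : ℕ × ℕ × ℕ × ℕ × ℕ =>
    InRatInterval p.1 p.2.1 p.2.2.1 p.2.2.2.1 p.2.2.2.2) := by
  have j : Primrec (fun p : ℕ × ℕ × ℕ × ℕ × ℕ => p.1) := Primrec.fst
  have g0 : Primrec (fun p : ℕ × ℕ × ℕ × ℕ × ℕ => p.2.1) := Primrec.fst.comp Primrec.snd
  have g1 : Primrec (fun p : ℕ × ℕ × ℕ × ℕ × ℕ => p.2.2.1) :=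
    Primrec.fst.comp (Primrec.snd.comp Primrec.snd)
  have D : Primrec (fun p : ℕ × ℕ × ℕ × ℕ × ℕ => p.2.2.2.1) :=
    Primrec.fst.comp (Primrec.snd.comp (Primrec.snd.comp Primrec.snd))
  have l : Primrec (fun p : ℕ × ℕ × ℕ × ℕ × ℕ => 2 ^ p.2.2.2.2) :=
    primrec_two_pow.comp (Primrec.snd.comp (Primrec.snd.comp (Primrec.snd.comp Primrec.snd)))
  have a := primrec_unpair_fst.comp (primrec_unpair_fst.comp j)
  have b := primrec_unpair_snd.comp (primrec_unpair_fst.comp j)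
  have d := Primrec.succ.comp (primrec_unpair_fst.comp (primrec_unpair_snd.comp j))
  have t := primrec_unpair_snd.comp (primrec_unpair_snd.comp j)
  have h1 := Primrec.nat_mul.comp d (Primrec.nat_mul.comp g1 l)
  have h2 := Primrec.nat_add.comp (Primrec.nat_mul.comp g0 l) D
  have h3 := Primrec.nat_mul.comp b l
  exact (Primrec.nat_lt.comp (Primrec.nat_add.comp (Primrec.nat_mul.comp a l) h1)
    (Primrec.nat_add.comp h3 (Primrec.nat_mul.comp d h2))).and
    (Primrec.nat_lt.comp (Primrec.nat_add.comp h3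
      (Primrec.nat_mul.comp d (Primrec.nat_add.comp h2 (Primrec.const 2))))
      (Primrec.nat_add.comp (Primrec.nat_mul.comp (Primrec.succ.comp (Primrec.nat_add.comp a t)) l)
        h1))

variable {L : FirstOrder.Language.{0, 0}} {M : Type*} [L.Structure M] {e : ℕ → M}
  {app : M → M → M → Prop} {α : Type*} [Primcodable α] {x y : ℕ → ℕ}

theorem ArithFun.proj (hc : NatCoding L e app) (hy : ArithFun L e y) :
    ArithFun L e (fun p : ℕ × ℕ => proj y p.1 p.2) :=
  hy.comp_primrec hc (Primrec.nat_mul.comp (primrec_two_pow.comp Primrec.fst)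
    (Primrec.nat_double_succ.comp Primrec.snd))

theorem ArithFun.dyadicSum (hc : NatCoding L e app) (hy : ArithFun L e y) :
    ArithFun L e (fun p : ℕ × ℕ => dyadicSum (_root_.proj y p.1) p.2) := by
  have h : ArithFun L e (fun q : ℕ × ℕ × ℕ => 2 * q.2.2 + _root_.proj y q.1 (q.2.1 + 2)) :=
    (ArithFun.of_primrec hc (Primrec.nat_add.comp (Primrec.nat_double.comp Primrec.fst)
      Primrec.snd)).comp hc (.pair hc (.of_primrec hc (Primrec.snd.comp Primrec.snd))
        ((ArithFun.proj hc hy).comp_primrec hc (Primrec.fst.pair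
          (Primrec.succ.comp (Primrec.succ.comp (Primrec.fst.comp Primrec.snd))))))
  exact natRec hc (.of_primrec hc (Primrec.const 0)) h

theorem ArithPred.inRatInterval (hc : NatCoding L e app) {j g0 g1 D l : α → ℕ}
    (hj : ArithFun L e j) (hg0 : ArithFun L e g0) (hg1 : ArithFun L e g1) (hD : ArithFun L e D)
    (hl : ArithFun L e l) :
    ArithPred L e (fun a => InRatInterval (j a) (g0 a) (g1 a) (D a) (l a)) :=
  ((ArithPred.of_primrecPred hc primrecPred_inRatInterval).comp hc
    (hj.pair hc (hg0.pair hc (hg1.pair hc (hD.pair hc hl))))).congr fun _ => Iff.rfl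

theorem arithPred_stepRel (hc : NatCoding L e app) (hx : ArithFun L e x) (hy : ArithFun L e y) :
    ArithPred L e (fun p : (ℕ × ℕ) × ℕ => StepRel x y p.1.1 p.1.2 p.2) := by
  have hm : Primrec (fun q : ((ℕ × ℕ) × ℕ) × ℕ => q.1.1.1.unpair.1) :=
    primrec_unpair_fst.comp (Primrec.fst.comp (Primrec.fst.comp Primrec.fst))
  have ha : Primrec (fun q : ((ℕ × ℕ) × ℕ) × ℕ => q.1.2.unpair.1) :=
    primrec_unpair_fst.comp (Primrec.snd.comp Primrec.fst)
  have hl : Primrec (fun q : ((ℕ × ℕ) × ℕ) × ℕ => q.1.2.unpair.2) :=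
    primrec_unpair_snd.comp (Primrec.snd.comp Primrec.fst)
  have hp := ArithFun.proj hc hy
  have hD : ArithFun L e (fun q : ((ℕ × ℕ) × ℕ) × ℕ =>
      dyadicSum (proj y q.1.1.1.unpair.1) q.1.2.unpair.2 + q.1.2.unpair.1) :=
    (ArithFun.of_primrec hc Primrec.nat_add).comp hc (.pair hc
      ((ArithFun.dyadicSum hc hy).comp_primrec hc (hm.pair hl)) (.of_primrec hc ha))
  have hX : ArithPred L e (fun q : ((ℕ × ℕ) × ℕ) × ℕ => proj x q.1.1.1.unpair.2 q.2 = 1) :=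
    ArithFun.eq hc ((ArithFun.proj hc hx).comp_primrec hc (g := fun q : ((ℕ × ℕ) × ℕ) × ℕ =>
      (q.1.1.1.unpair.2, q.2)) ((primrec_unpair_snd.comp (Primrec.fst.comp (Primrec.fst.comp
        Primrec.fst))).pair Primrec.snd)) (.of_primrec hc (Primrec.const 1))
  have hI := ArithPred.inRatInterval hc
    (j := fun q : ((ℕ × ℕ) × ℕ) × ℕ => q.2) (.of_primrec hc Primrec.snd)
    (hp.comp_primrec hc (hm.pair (Primrec.const 0)))
    (hp.comp_primrec hc (hm.pair (Primrec.const 1))) hD (.of_primrec hc hl)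
  exact (ArithPred.of_primrecPred hc (primrecPred_refines.comp
    ((Primrec.snd.comp Primrec.fst).pair Primrec.snd))).and (.exists_ hc (hX.and hI))

theorem arithFun_stepSeq (hc : NatCoding L e app) (hx : ArithFun L e x) (hy : ArithFun L e y)
    (h : ∀ k e, ∃ e', StepRel x y k e e') : ArithFun L e (stepSeq x y) := by
  have h1 : ArithFun L e (fun p : ℕ × ℕ => sInf {e' | StepRel x y p.1 p.2 e'}) :=
    .nat_sInf hc (arithPred_stepRel hc hx hy) fun p => h p.1 p.2
  have h2 := ArithFun.natRec hc (α := Unit) (f := fun _ => 0)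
    (.of_primrec hc (Primrec.const 0)) (h1.comp_primrec hc (g := fun q : Unit × ℕ × ℕ => q.2)
      Primrec.snd)
  exact h2.comp_primrec hc (g := fun k => ((), k)) ((Primrec.const ()).pair Primrec.id)

/-- Entry `i` is a primitive recursive function of `i` and `E (i - 1)`. -/
theorem arithFun_digitCode (hc : NatCoding L e app) {E : ℕ → ℕ} (hE : ArithFun L e E) :
    ArithFun L e (digitCode E) := by
  have h : Primrec (fun p : ℕ × ℕ => if p.1 < 2 then 0 else
      p.2.unpair.1 / 2 ^ (p.2.unpair.2 - (p.1 - 1)) % 2) :=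
    Primrec.ite (Primrec.nat_lt.comp Primrec.fst (Primrec.const 2)) (Primrec.const 0)
      (Primrec.nat_mod.comp (Primrec.nat_div.comp (primrec_unpair_fst.comp Primrec.snd)
        (primrec_two_pow.comp (Primrec.nat_sub.comp (primrec_unpair_snd.comp Primrec.snd)
          (Primrec.nat_sub.comp Primrec.fst (Primrec.const 1))))) (Primrec.const 2))
  exact (ArithFun.of_primrec hc h).comp hc (.pair hc (.of_primrec hc Primrec.id)
    (hE.comp_primrec hc (Primrec.nat_sub.comp Primrec.id (Primrec.const 1))))

end Definability

theorem mainTheorem7 (α : Ordinal.{u}) (y x : ℕ → ℕ) (hy : InLevel α y) (hx : InLevel α x)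
    (Y : ℕ → ℝ) (hY : ∀ n, CodesReal (proj y n) (Y n))
    (hlim : Filter.Tendsto Y Filter.atTop (nhds (Y 0)))
    (hG : ∀ n, openOfCode (proj x n) ∈ codedOpenSupersets α) :
    ∃ (c : ℝ) (M : ℕ), Y 0 + c ∈ gdeltaOfCode x ∧ (∀ m, M < m → Y m + c ∈ gdeltaOfCode x) ∧
      ∃ f : ℕ → ℕ, CodesReal f c ∧ InLevel (α + Ordinal.omega0) f := by
  have hα := omega0_le_of_inLevel hx
  have hc := natCoding_levelNat hα hx
  have hstep : ∀ k e, ∃ e', StepRel x y k e e' :=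
    fun k => exists_stepRel (hY _) (hG _).2.1
  have hS : ∀ k, StepRel x y k (stepSeq x y k) (stepSeq x y (k + 1)) :=
    fun k => Nat.sInf_mem (hstep k (stepSeq x y k))
  obtain ⟨c, hcode, hmem⟩ := exists_codesReal_digitCode (fun k => (hS k).1) rfl
  have hT : ∀ m, Y m + c ∈ gdeltaOfCode x := by
    refine fun m => Set.mem_iInter.2 fun n => ?_
    -- The requirement for `⟨m, n⟩` is met by the interval chosen at that step, which has the next
    -- index.
    have hm := hmem (Nat.pair m n + 1)
    have := (hS (Nat.pair m n)).add_mem (hY _) hm.1 hm.2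
    simpa only [Nat.unpair_pair] using this
  -- Every translate lands in `T`, so `M = 0` will do.
  refine ⟨c, 0, hT 0, fun m _ => hT m, _, hcode, ?_⟩
  have h1 := inLevel_add_one_of_arithFun hα hx (arithFun_digitCode hc (arithFun_stepSeq hc
    (arithFun_of_inLevel hα hx) (arithFun_of_inLevel hα hy) hstep))
  exact constructibleLevel_mono (by gcongr; exact Ordinal.one_lt_omega0.le) h1
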